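/- Let $T>0$, let $(\Omega,\mathcal F,\mathbb P)$ be a probability space with a filtration $\mathbb F=(\mathcal F_t)_{t\in[0,T]}$, and let $\mathcal K(\mathbb R^d)$ be the set of nonempty compact convex subsets of $\mathbb R^d$, with the Hausdorff distance $h$ (extended to nonempty closed sets with values in $[0,\infty]$). A set-valued map $F$ is called measurable if $\{F\cap B\neq\emptyset\}$ is measurable for every closed $B\subset\mathbb R^d$; a set-valued process is $\mathbb F$-progressively measurable if, for every $t\in[0,T]$, its restriction to $[0,t]\times\Omega$ is $\mathcal B([0,t])\otimes\mathcal F_t$-measurable. Let $\mathscr L^2_{\mathbb F}([0,T]\times\Omega,\mathcal K(\mathbb R^d))$ be the set of $\mathbb F$-progressively measurable processes $\Phi$ with values in $\mathcal K(\mathbb R^d)$ and $\mathbb E\int_0^T h^2(\Phi_s,\{0\})\,ds<\infty$. For such $\Phi$, let $S^2_{\mathbb F}(\Phi)$ be the set of $\mathbb F$-progressively measurable $\varphi$ with $\mathbb E\int_0^T|\varphi_s|^2ds<\infty$ and $\varphi\in\Phi$ $ds\otimes d\mathbb P$-a.e. For $t\in[0,T]$ put $J_{t,T}[S^2_{\mathbb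 F}(\Phi)]=\{\int_t^T\varphi_s\,ds:\varphi\in S^2_{\mathbb F}(\Phi)\}\subset L^2_{\mathcal F_T}(\Omega,\mathbb R^d)$. The set-valued integral $\int_t^T\Phi_s\,ds$ is the (a.s. unique) $\mathcal F_T$-measurable random set $X$ with nonempty closed values in $\mathbb R^d$ whose set of selections in $L^2_{\mathcal F_T}(\Omega,\mathbb R^d)$, $\{\eta\in L^2_{\mathcal F_T}(\Omega,\mathbb R^d):\eta\in X\text{ a.s.}\}$, is nonempty and equals the $L^2$-closure of the $\mathcal F_T$-decomposable hull of $J_{t,T}[S^2_{\mathbb F}(\Phi)]$. Here a set $V\subset L^2$ is $\mathcal F_T$-decomposable if $\mathbf 1_Df+\mathbf 1_{D^c}g\in V$ for all $f,g\in V$, $D\in\mathcal F_T$, and the decomposable hull of a set is the smallest decomposable set containing it. **Proposition.** Let $\Phi^1,\Phi^2\in\mathscr L^2_{\mathbb F}([0,T]\times\Omega,\mathcal K(\mathbb R^d))$ and $t\in[0,T]$. Then the integrals $\int_t^T\Phi^1_s\,ds$ and $\int_t^T\Phi^2_s\,ds$ exist and, for all versions of them, $$h^2\Big(\int_t^T\Phi^1_s\,ds,\int_t^T\Phi^2_s\,ds\Big)\le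 (T-t)\int_t^T h^2(\Phi^1_s,\Phi^2_s)\,ds<\infty\qquad \mathbb P\text{-a.s.}$$ -/

import Mathlib

open MeasureTheory Set
open scoped ENNReal

/-- `ℝ^d` with its Euclidean norm. -/
abbrev Vec (d : ℕ) : Type := EuclideanSpace ℝ (Fin d)

/-- `A ∈ 𝒦(ℝ^d)`: `A` is a nonempty compact convex set. -/
def IsConvexBody {d : ℕ} (A : Set (Vec d)) : Prop :=
  A.Nonempty ∧ IsCompact A ∧ Convex ℝ A

/-- (Strong) measurability of a set-valued function: the set of points whose value hits `B` is
measurable, for every closed `B`. -/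
def SetValuedMeasurable {d : ℕ} {α : Type*} (m : MeasurableSpace α) (F : α → Set (Vec d)) : Prop :=
  ∀ B : Set (Vec d), IsClosed B → MeasurableSet[m] {a | (F a ∩ B).Nonempty}

/-- Lebesgue measure on the time interval `[0,T]`. -/
noncomputable def timeMeasure (T : ℝ) : Measure (Icc (0 : ℝ) T) :=
  Measure.comap Subtype.val volume

section Processes

variable {d : ℕ} {T : ℝ} {Ω : Type*} {mΩ : MeasurableSpace Ω}

/-- Progressive measurability of a set-valued process: for every `t`, its restriction to
`[0,t] × Ω` is `𝓑([0,t]) ⊗ ℱ_t`-measurable. -/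
def SetValuedProgMeasurable (ℱ : Filtration (Icc (0 : ℝ) T) mΩ)
    (Φ : Icc (0 : ℝ) T → Ω → Set (Vec d)) : Prop :=
  ∀ t : Icc (0 : ℝ) T,
    SetValuedMeasurable (@Prod.instMeasurableSpace (Iic t) Ω Subtype.instMeasurableSpace (ℱ t))
      (fun p : Iic t × Ω => Φ p.1 p.2)

/-- `Φ ∈ ℒ²_𝔽([0,T] × Ω, 𝒦(ℝ^d))`: a progressively measurable process with nonempty compact convex
values which is square-integrably bounded, `𝔼[∫_0^T ‖Φ_s‖² ds] < ∞` with `‖A‖ = h(A, {0})`. -/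
structure IsSquareIntegrablyBounded (ℱ : Filtration (Icc (0 : ℝ) T) mΩ) (P : Measure Ω)
    (Φ : Icc (0 : ℝ) T → Ω → Set (Vec d)) : Prop where
  isConvexBody : ∀ s ω, IsConvexBody (Φ s ω)
  progMeasurable : SetValuedProgMeasurable ℱ Φ
  bounded : ∫⁻ ω, ∫⁻ s, (Metric.hausdorffEDist (Φ s ω) {0}) ^ 2 ∂(timeMeasure T) ∂P < ∞

/-- `S²_𝔽(Φ)`: the square-integrable progressively measurable processes `φ` with `φ ∈ Φ`
almost everywhere for `ds ⊗ dP`. -/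
def progSelections (ℱ : Filtration (Icc (0 : ℝ) T) mΩ) (P : Measure Ω)
    (Φ : Icc (0 : ℝ) T → Ω → Set (Vec d)) : Set (Icc (0 : ℝ) T → Ω → Vec d) :=
  {φ | IsStronglyProgressive ℱ φ ∧ MemLp (fun p : Icc (0 : ℝ) T × Ω => φ p.1 p.2) 2 ((timeMeasure T).prod P) ∧
    ∀ᵐ p ∂((timeMeasure T).prod P), φ p.1 p.2 ∈ Φ p.1 p.2}

/-- `J_{t,T}[K]`: the random variables `∫_t^T φ_s ds`, `φ ∈ K`, as elements of `L²(Ω, ℝ^d)`. -/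
def timeIntegrals (P : Measure Ω) (t : Icc (0 : ℝ) T) (K : Set (Icc (0 : ℝ) T → Ω → Vec d)) :
    Set (Lp (Vec d) 2 P) :=
  {η | ∃ φ ∈ K, η =ᵐ[P] fun ω => ∫ s in Ici t, φ s ω ∂(timeMeasure T)}

/-- `S²_𝒢(X)`: the square-integrable `𝒢`-measurable selections of `X`, as a subset of
`L²(Ω, ℝ^d)` (classes having a `𝒢`-measurable representative). -/
def sqSelections (P : Measure Ω) (𝒢 : MeasurableSpace Ω) (X : Ω → Set (Vec d)) :
    Set (Lp (Vec d) 2 P) :=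
  {η | AEStronglyMeasurable[𝒢] η P ∧ ∀ᵐ ω ∂P, η ω ∈ X ω}

/-- `V` is decomposable with respect to `𝒢`: `1_D f + 1_{Dᶜ} g ∈ V` for all `f, g ∈ V`, `D ∈ 𝒢`. -/
def IsDecomposable {P : Measure Ω} (𝒢 : MeasurableSpace Ω) (V : Set (Lp (Vec d) 2 P)) : Prop :=
  ∀ f ∈ V, ∀ g ∈ V, ∀ D : Set Ω, MeasurableSet[𝒢] D → ∀ k : Lp (Vec d) 2 P,
    (k =ᵐ[P] fun ω => D.indicator f ω + Dᶜ.indicator g ω) → k ∈ V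

/-- The decomposable hull: the smallest decomposable set containing `V`. -/
def decHull {P : Measure Ω} (𝒢 : MeasurableSpace Ω) (V : Set (Lp (Vec d) 2 P)) :
    Set (Lp (Vec d) 2 P) :=
  ⋂₀ {W | IsDecomposable 𝒢 W ∧ V ⊆ W}

/-- The last sub-σ-algebra `ℱ_T` of a filtration indexed by `[0,T]`. -/
abbrev terminalSigma (hT : 0 < T) (ℱ : Filtration (Icc (0 : ℝ) T) mΩ) : MeasurableSpace Ω :=
  ℱ ⟨T, right_mem_Icc.2 hT.le⟩

/-- `X` is (a version of) the set-valued time integral `∫_t^T Φ_s ds`: an `ℱ_T`-measurable random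
set with nonempty closed values, admitting a square-integrable selection, whose set of
square-integrable `ℱ_T`-measurable selections is the `L²`-closure of the `ℱ_T`-decomposable hull
of `J_{t,T}[S²_𝔽(Φ)]`. -/
structure IsSetTimeIntegral (hT : 0 < T) (ℱ : Filtration (Icc (0 : ℝ) T) mΩ) (P : Measure Ω)
    (Φ : Icc (0 : ℝ) T → Ω → Set (Vec d)) (t : Icc (0 : ℝ) T) (X : Ω → Set (Vec d)) : Prop where
  nonempty : ∀ ω, (X ω).Nonempty
  isClosed : ∀ ω, IsClosed (X ω)
  measurable : SetValuedMeasurable (terminalSigma hT ℱ) X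
  integrable : (sqSelections P (terminalSigma hT ℱ) X).Nonempty
  selections : sqSelections P (terminalSigma hT ℱ) X =
    closure (decHull (terminalSigma hT ℱ) (timeIntegrals P t (progSelections ℱ P Φ)))

end Processes

/-! ### Measurable set-valued functions and measurable selections -/

section SetValued

variable {d : ℕ} {α : Type*}

/-! The estimate is Cauchy–Schwarz in time applied to well-chosen selections. Given a selection `φ`
of `Φ¹`, let `ψ` be a measurable nearest-point projection of `φ` onto `Φ²`, so that `|φ - ψ| ≤ h(Φ¹,
Φ²)` almost everywhere. Then `∫_t^T φ` is a.s. within `ρ = ((T - t) ∫_t^T h²(Φ¹, Φ²))^(1/2)` of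
`∫_t^T ψ`, which lies a.s. in the second integral `Y`.

The condition "a.s. within `ρ` of `Y`" is pointwise and closed, hence stable under pasting and under
`L²` limits. It therefore passes from the time integrals to the closure of their decomposable hull,
that is, to every square-integrable selection of the first integral `X`, and then to all points of
`X` because such selections are pointwise dense in `X`. Exchanging the roles bounds the Hausdorff
distance (`IsSetTimeIntegral.ae_infEDist_le`).

Existence of the integrals is the Hiai–Umegaki theorem
(`IsDecomposable.exists_sqSelections_eq_closure`), applied to a hull that is nonempty because
projecting the zero process gives a selection. Measurable projections come from
`SetValuedMeasurable.measurable_nearest`. -/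

theorem infEDist_le_iff_inter_closedBall_nonempty {A : Set (Vec d)} (hA : IsClosed A)
    (q : Vec d) (r : ℝ) (hr : 0 ≤ r) :
    Metric.infEDist q A ≤ ENNReal.ofReal r ↔ (A ∩ Metric.closedBall q r).Nonempty := by
  constructor
  · intro h
    have hne : A.Nonempty := by
      rw [nonempty_iff_ne_empty]
      rintro rfl
      simp at h
    obtain ⟨y, hy, hqy⟩ := hA.exists_infDist_eq_dist hne q
    refine ⟨y, hy, ?_⟩
    rw [Metric.mem_closedBall, dist_comm, ← hqy]
    exact ENNReal.toReal_le_of_le_ofReal hr h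
  · rintro ⟨y, hy, hyq⟩
    refine (Metric.infEDist_le_edist_of_mem hy).trans ?_
    rw [edist_comm, edist_dist]
    exact ENNReal.ofReal_le_ofReal hyq

variable {m : MeasurableSpace α} {F : α → Set (Vec d)}

theorem SetValuedMeasurable.inter (hF : SetValuedMeasurable m F) {C : Set (Vec d)}
    (hC : IsClosed C) : SetValuedMeasurable m fun a => F a ∩ C := by
  intro B hB
  simpa only [inter_assoc] using hF (C ∩ B) (hC.inter hB)

theorem SetValuedMeasurable.measurable_infEDist_const (hF : SetValuedMeasurable m F)
    (hc : ∀ a, IsClosed (F a)) (q : Vec d) : Measurable fun a => Metric.infEDist q (F a) := by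
  refine measurable_of_Iic fun r => ?_
  rcases eq_or_ne r ∞ with rfl | hr
  · simp
  · have : (fun a => Metric.infEDist q (F a)) ⁻¹' Iic r
        = {a | (F a ∩ Metric.closedBall q r.toReal).Nonempty} := by
      ext a
      rw [mem_preimage, mem_Iic, mem_ofPred_eq,
        ← infEDist_le_iff_inter_closedBall_nonempty (hc a) q _ ENNReal.toReal_nonneg,
        ENNReal.ofReal_toReal hr]
    rw [this]
    exact hF _ Metric.isClosed_closedBall

/-- The distance is a Carathéodory function: continuous in the point, measurable in the parameter.
-/
theorem SetValuedMeasurable.measurable_infEDist (hF : SetValuedMeasurable m F)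
    (hc : ∀ a, IsClosed (F a)) {q : α → Vec d} (hq : Measurable q) :
    Measurable fun a => Metric.infEDist (q a) (F a) := by
  have h := measurable_uncurry_of_continuous_of_measurable
    (u := fun (x : Vec d) (a : α) => Metric.infEDist x (F a))
    (fun _ => Metric.continuous_infEDist) (fun x => hF.measurable_infEDist_const hc x)
  exact h.comp (hq.prodMk measurable_id)

/-- The points of `A` nearest to `q`. -/
def nearestPoints (q : Vec d) (A : Set (Vec d)) : Set (Vec d) :=
  A ∩ {x | edist q x ≤ Metric.infEDist q A}

theorem nearestPoints_subset (q : Vec d) (A : Set (Vec d)) : nearestPoints q A ⊆ A :=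
  inter_subset_left

theorem edist_eq_of_mem_nearestPoints {q x : Vec d} {A : Set (Vec d)}
    (hx : x ∈ nearestPoints q A) : edist q x = Metric.infEDist q A :=
  le_antisymm hx.2 (Metric.infEDist_le_edist_of_mem hx.1)

theorem isClosed_nearestPoints (q : Vec d) {A : Set (Vec d)} (hA : IsClosed A) :
    IsClosed (nearestPoints q A) :=
  hA.inter (isClosed_le (by fun_prop) continuous_const)

theorem exists_edist_le_infEDist (q : Vec d) {A : Set (Vec d)} (hA : IsClosed A)
    (hne : A.Nonempty) : ∃ x ∈ A, edist q x ≤ Metric.infEDist q A := by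
  obtain ⟨y, hy, hqy⟩ := hA.exists_infDist_eq_dist hne q
  refine ⟨y, hy, ?_⟩
  rw [edist_dist, ← hqy]
  exact ENNReal.ofReal_toReal_le

theorem nearestPoints_nonempty (q : Vec d) {A : Set (Vec d)} (hA : IsClosed A)
    (hne : A.Nonempty) : (nearestPoints q A).Nonempty :=
  exists_edist_le_infEDist q hA hne

theorem isCompact_nearestPoints (q : Vec d) {A : Set (Vec d)} (hA : IsClosed A) :
    IsCompact (nearestPoints q A) := by
  rcases A.eq_empty_or_nonempty with rfl | hne
  · simp [nearestPoints]
  · refine Metric.isCompact_of_isClosed_isBounded (isClosed_nearestPoints q hA)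
      ((Metric.isBounded_closedBall (x := q) (r := Metric.infDist q A)).subset fun x hx => ?_)
    have h := hx.2
    rw [mem_ofPred_eq, edist_comm, edist_dist] at h
    exact (ENNReal.ofReal_le_iff_le_toReal (Metric.infEDist_ne_top hne)).1 h

/-- Since distances to closed sets are attained, a nearest point lies in `B` exactly when `F a ∩ B`
is as close to `q a` as `F a` is. This compares two measurable functions. -/
theorem SetValuedMeasurable.nearestPoints (hF : SetValuedMeasurable m F)
    (hc : ∀ a, IsClosed (F a)) (hne : ∀ a, (F a).Nonempty) {q : α → Vec d} (hq : Measurable q) :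
    SetValuedMeasurable m fun a => nearestPoints (q a) (F a) := by
  intro B hB
  have : {a | (_root_.nearestPoints (q a) (F a) ∩ B).Nonempty}
      = {a | Metric.infEDist (q a) (F a ∩ B) ≤ Metric.infEDist (q a) (F a)} := by
    ext a
    constructor
    · rintro ⟨x, ⟨hx, hqx⟩, hxB⟩
      exact (Metric.infEDist_le_edist_of_mem (mem_inter hx hxB)).trans hqx
    · intro h
      have hne' : (F a ∩ B).Nonempty := by
        rw [nonempty_iff_ne_empty]
        intro h0
        rw [mem_ofPred_eq, h0, Metric.infEDist_empty, top_le_iff] at h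
        exact Metric.infEDist_ne_top (hne a) h
      obtain ⟨x, hx, hqx⟩ := exists_edist_le_infEDist (q a) ((hc a).inter hB) hne'
      exact ⟨x, ⟨hx.1, hqx.trans h⟩, hx.2⟩
  rw [this]
  exact measurableSet_le ((hF.inter hB).measurable_infEDist (fun a => (hc a).inter hB) hq)
    (hF.measurable_infEDist hc hq)

/-- Iterated nearest point sets of `A` along a dense sequence. -/
noncomputable def nearestSeq (A : Set (Vec d)) : ℕ → Set (Vec d)
  | 0 => nearestPoints 0 A
  | n + 1 => nearestPoints (TopologicalSpace.denseSeq (Vec d) n) (nearestSeq A n)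

theorem isClosed_nearestSeq {A : Set (Vec d)} (hA : IsClosed A) :
    ∀ n, IsClosed (nearestSeq A n)
  | 0 => isClosed_nearestPoints _ hA
  | n + 1 => isClosed_nearestPoints _ (isClosed_nearestSeq hA n)

theorem nearestSeq_nonempty {A : Set (Vec d)} (hA : IsClosed A) (hne : A.Nonempty) :
    ∀ n, (nearestSeq A n).Nonempty
  | 0 => nearestPoints_nonempty _ hA hne
  | n + 1 => nearestPoints_nonempty _ (isClosed_nearestSeq hA n) (nearestSeq_nonempty hA hne n)

theorem isCompact_nearestSeq_zero {A : Set (Vec d)} (hA : IsClosed A) :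
    IsCompact (nearestSeq A 0) := isCompact_nearestPoints _ hA

theorem nearestSeq_succ_subset (A : Set (Vec d)) (n : ℕ) : nearestSeq A (n + 1) ⊆ nearestSeq A n :=
  nearestPoints_subset _ _

theorem iInter_nearestSeq_nonempty {A : Set (Vec d)} (hA : IsClosed A) (hne : A.Nonempty) :
    (⋂ n, nearestSeq A n).Nonempty :=
  IsCompact.nonempty_iInter_of_sequence_nonempty_isCompact_isClosed _ (nearestSeq_succ_subset A)
    (nearestSeq_nonempty hA hne) (isCompact_nearestSeq_zero hA) (isClosed_nearestSeq hA)

/-- Two points of the intersection have equal distances to every point of a dense sequence, hence to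
every point, in particular to one of themselves. -/
theorem iInter_nearestSeq_subsingleton (A : Set (Vec d)) :
    (⋂ n, nearestSeq A n).Subsingleton := by
  intro x hx y hy
  rw [mem_iInter] at hx hy
  have h : (fun q => edist q x) = fun q => edist q y := by
    refine Continuous.ext_on (TopologicalSpace.denseRange_denseSeq (Vec d)) (by fun_prop)
      (by fun_prop) ?_
    rintro _ ⟨n, rfl⟩
    exact (edist_eq_of_mem_nearestPoints (hx (n + 1))).trans
      (edist_eq_of_mem_nearestPoints (hy (n + 1))).symm
  have h' := congrFun h x
  simp only [edist_self] at h'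
  exact (edist_eq_zero.1 h'.symm)

open Classical in
/-- A point selected from each nonempty closed set, in a measurable way. -/
noncomputable def select (A : Set (Vec d)) : Vec d :=
  if h : (⋂ n, nearestSeq A n).Nonempty then h.some else 0

theorem select_mem_iInter {A : Set (Vec d)} (hA : IsClosed A) (hne : A.Nonempty) :
    select A ∈ ⋂ n, nearestSeq A n := by
  have h := iInter_nearestSeq_nonempty hA hne
  rw [select, dif_pos h]
  exact h.some_mem

theorem select_mem {A : Set (Vec d)} (hA : IsClosed A) (hne : A.Nonempty) : select A ∈ A :=
  nearestPoints_subset _ _ (mem_iInter.1 (select_mem_iInter hA hne) 0)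

theorem SetValuedMeasurable.nearestSeq (hF : SetValuedMeasurable m F)
    (hc : ∀ a, IsClosed (F a)) (hne : ∀ a, (F a).Nonempty) :
    ∀ n, SetValuedMeasurable m fun a => nearestSeq (F a) n
  | 0 => hF.nearestPoints hc hne measurable_const
  | n + 1 => (hF.nearestSeq hc hne n).nearestPoints (fun a => isClosed_nearestSeq (hc a) n)
      (fun a => nearestSeq_nonempty (hc a) (hne a) n) measurable_const

/-- Measurable selection theorem for nonempty closed values in `ℝ^d`. -/
theorem SetValuedMeasurable.measurable_select (hF : SetValuedMeasurable m F)
    (hc : ∀ a, IsClosed (F a)) (hne : ∀ a, (F a).Nonempty) : Measurable fun a => select (F a) := by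
  refine measurable_of_isClosed fun B hB => ?_
  have : (fun a => select (F a)) ⁻¹' B = ⋂ n, {a | (_root_.nearestSeq (F a) n ∩ B).Nonempty} := by
    ext a
    have hs := select_mem_iInter (hc a) (hne a)
    rw [mem_iInter]
    constructor
    · exact fun h n => ⟨_, mem_iInter.1 hs n, h⟩
    · intro h
      -- If every stage meets `B`, compactness gives a common point in `B`; uniqueness identifies it
      -- with the selected point.
      obtain ⟨x, hx⟩ := IsCompact.nonempty_iInter_of_sequence_nonempty_isCompact_isClosed
        (fun n => _root_.nearestSeq (F a) n ∩ B)
        (fun n => inter_subset_inter_left _ (nearestSeq_succ_subset _ n)) h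
        ((isCompact_nearestSeq_zero (hc a)).inter_right hB)
        (fun n => (isClosed_nearestSeq (hc a) n).inter hB)
      rw [mem_iInter] at hx
      have hx' : x = select (F a) :=
        iInter_nearestSeq_subsingleton (F a) (mem_iInter.2 fun n => (hx n).1) hs
      rw [mem_preimage, ← hx']
      exact (hx 0).2
  rw [this]
  exact MeasurableSet.iInter fun n => hF.nearestSeq hc hne n B hB

/-- A measurable point of `A` nearest to `q`. -/
noncomputable def nearest (q : Vec d) (A : Set (Vec d)) : Vec d := select (nearestPoints q A)

theorem nearest_mem_nearestPoints (q : Vec d) {A : Set (Vec d)} (hA : IsClosed A)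
    (hne : A.Nonempty) : nearest q A ∈ nearestPoints q A :=
  select_mem (isClosed_nearestPoints q hA) (nearestPoints_nonempty q hA hne)

theorem nearest_mem (q : Vec d) {A : Set (Vec d)} (hA : IsClosed A) (hne : A.Nonempty) :
    nearest q A ∈ A :=
  (nearest_mem_nearestPoints q hA hne).1

theorem edist_nearest (q : Vec d) {A : Set (Vec d)} (hA : IsClosed A) (hne : A.Nonempty) :
    edist q (nearest q A) = Metric.infEDist q A :=
  edist_eq_of_mem_nearestPoints (nearest_mem_nearestPoints q hA hne)

theorem SetValuedMeasurable.measurable_nearest (hF : SetValuedMeasurable m F)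
    (hc : ∀ a, IsClosed (F a)) (hne : ∀ a, (F a).Nonempty) {q : α → Vec d} (hq : Measurable q) :
    Measurable fun a => nearest (q a) (F a) :=
  (hF.nearestPoints hc hne hq).measurable_select (fun a => isClosed_nearestPoints _ (hc a))
    fun a => nearestPoints_nonempty _ (hc a) (hne a)

/-- The closure of a sequence of measurable functions is a measurable set-valued function. -/
theorem setValuedMeasurable_closure_range {v : ℕ → α → Vec d} (hv : ∀ i, Measurable (v i)) :
    SetValuedMeasurable m fun a => closure (range fun i => v i a) := by
  -- Compact sets come first: on `K` the distance to the closure attains its minimum, so hitting `K`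
  -- means that the points `v i a` come arbitrarily close to `K`. Closed sets are then exhausted by
  -- balls.
  have key : ∀ K : Set (Vec d), IsCompact K →
      MeasurableSet {a | (closure (range fun i => v i a) ∩ K).Nonempty} := by
    intro K hK
    have : {a | (closure (range fun i => v i a) ∩ K).Nonempty}
        = {a | (⨅ i, Metric.infEDist (v i a) K) ≤ 0} := by
      ext a
      constructor
      · rintro ⟨x, hx, hxK⟩
        rw [mem_ofPred_eq]
        refine le_of_forall_gt_imp_ge_of_dense fun ε hε => ?_
        rw [EMetric.mem_closure_iff] at hx
        obtain ⟨_, ⟨i, rfl⟩, hi⟩ := hx ε hε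
        exact (iInf_le _ i).trans ((Metric.infEDist_le_edist_of_mem hxK).trans
          (by rw [edist_comm]; exact hi.le))
      · intro h
        have h' : (⨅ i, Metric.infEDist (v i a) K) = 0 := le_antisymm h bot_le
        have hK' : K.Nonempty := by
          rw [nonempty_iff_ne_empty]
          rintro rfl
          simp at h'
        obtain ⟨x, hx, hmin⟩ := hK.exists_isMinOn hK'
          (Metric.continuous_infEDist (s := range fun i => v i a)).continuousOn
        refine ⟨x, ?_, hx⟩
        rw [Metric.mem_closure_iff_infEDist_zero]
        refine le_antisymm (le_of_forall_gt_imp_ge_of_dense fun ε hε => ?_) bot_le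
        obtain ⟨i, hi⟩ : ∃ i, Metric.infEDist (v i a) K < ε := by
          rwa [← iInf_lt_iff, h']
        obtain ⟨y, hy, hyi⟩ := Metric.infEDist_lt_iff.1 hi
        exact (hmin hy).trans ((Metric.infEDist_le_edist_of_mem (mem_range_self i)).trans
          (by rw [edist_comm]; exact hyi.le))
    rw [this]
    exact measurableSet_le (Measurable.iInf fun i =>
      Metric.continuous_infEDist.measurable.comp (hv i)) measurable_const
  intro B hB
  have : {a | (closure (range fun i => v i a) ∩ B).Nonempty}
      = ⋃ n : ℕ, {a | (closure (range fun i => v i a) ∩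
          (Metric.closedBall 0 n ∩ B)).Nonempty} := by
    ext a
    rw [mem_iUnion]
    constructor
    · rintro ⟨x, hx, hxB⟩
      obtain ⟨n, hn⟩ := exists_nat_ge (dist x 0)
      exact ⟨n, x, hx, hn, hxB⟩
    · rintro ⟨n, x, hx, -, hxB⟩
      exact ⟨x, hx, hxB⟩
  rw [this]
  exact MeasurableSet.iUnion fun n => key _ ((isCompact_closedBall _ _).inter_right hB)

end SetValued

/-! ### Decomposable subsets of `L²` -/

section SquareIntegrable

variable {α E : Type*} {mα : MeasurableSpace α} {μ : Measure α} [NormedAddCommGroup E]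

theorem eLpNorm_two_sq (f : α → E) (μ : Measure α) :
    eLpNorm f 2 μ ^ 2 = ∫⁻ a, ‖f a‖ₑ ^ 2 ∂μ := by
  have h := eLpNorm_nnreal_pow_eq_lintegral (f := f) (μ := μ) (p := 2) two_ne_zero
  simpa using h

theorem memLp_two_iff_lintegral {f : α → E} (hf : AEStronglyMeasurable f μ) :
    MemLp f 2 μ ↔ ∫⁻ a, ‖f a‖ₑ ^ 2 ∂μ < ∞ := by
  rw [MemLp, and_iff_right hf, ← eLpNorm_two_sq, ENNReal.pow_lt_top_iff]
  simp

end SquareIntegrable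

theorem measurableSet_edist_le {d : ℕ} {α : Type*} {m : MeasurableSpace α} {f g h : α → Vec d}
    (hf : Measurable f) (hg : Measurable g) (hh : Measurable h) :
    MeasurableSet {a | edist (f a) (h a) ≤ edist (g a) (h a)} :=
  measurableSet_le (hf.edist hh) (hg.edist hh)

section Decomposable

variable {d : ℕ} {Ω : Type*} {𝒢 : MeasurableSpace Ω} {mΩ : MeasurableSpace Ω} {P : Measure Ω}
  {V : Set (Lp (Vec d) 2 P)}

theorem subset_decHull (𝒢 : MeasurableSpace Ω) (V : Set (Lp (Vec d) 2 P)) : V ⊆ decHull 𝒢 V :=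
  fun _ hf _ hW => hW.2 hf

theorem isDecomposable_decHull (𝒢 : MeasurableSpace Ω) (V : Set (Lp (Vec d) 2 P)) :
    IsDecomposable 𝒢 (decHull 𝒢 V) :=
  fun f hf g hg D hD k hk W hW => hW.1 f (hf W hW) g (hg W hW) D hD k hk

theorem decHull_subset {W : Set (Lp (Vec d) 2 P)} (hW : IsDecomposable 𝒢 W) (h : V ⊆ W) :
    decHull 𝒢 V ⊆ W :=
  fun _ hf => hf W ⟨hW, h⟩

theorem isDecomposable_aestronglyMeasurable (𝒢 : MeasurableSpace Ω) :
    IsDecomposable 𝒢 {f : Lp (Vec d) 2 P | AEStronglyMeasurable[𝒢] f P} := by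
  rintro f ⟨f', hf', hff'⟩ g ⟨g', hg', hgg'⟩ D hD k hk
  refine ⟨fun ω => D.indicator f' ω + Dᶜ.indicator g' ω,
    (hf'.indicator hD).add (hg'.indicator hD.compl), ?_⟩
  filter_upwards [hk, hff', hgg'] with ω h1 h2 h3
  by_cases hω : ω ∈ D <;> simp [h1, hω, h2, h3]

/-- The elements of `L²` staying a.s. in a given set-valued map form a decomposable set. -/
theorem isDecomposable_setOf_ae (𝒢 : MeasurableSpace Ω) (p : Ω → Vec d → Prop) :
    IsDecomposable 𝒢 {f : Lp (Vec d) 2 P | ∀ᵐ ω ∂P, p ω (f ω)} := by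
  intro f hf g hg D hD k hk
  rw [mem_ofPred_eq] at *
  filter_upwards [hk, hf, hg] with ω h1 h2 h3
  by_cases hω : ω ∈ D <;> simpa [h1, hω]

/-- An `L²`-convergent sequence has an a.e. convergent subsequence, along which the closed condition
survives. -/
theorem isClosed_setOf_ae {p : Ω → Vec d → Prop} (hp : ∀ ω, IsClosed {x | p ω x}) :
    IsClosed {f : Lp (Vec d) 2 P | ∀ᵐ ω ∂P, p ω (f ω)} := by
  refine IsSeqClosed.isClosed fun u f hu huf => ?_
  obtain ⟨ns, -, hns⟩ := (tendstoInMeasure_of_tendsto_Lp huf).exists_seq_tendsto_ae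
  rw [mem_ofPred_eq]
  filter_upwards [hns, ae_all_iff.2 hu] with ω h1 h2
  exact (hp ω).mem_of_tendsto h1 (Filter.Eventually.of_forall fun n => h2 _)

theorem isClosed_sqSelections (h𝒢 : 𝒢 ≤ mΩ) {X : Ω → Set (Vec d)} (hX : ∀ ω, IsClosed (X ω)) :
    IsClosed (sqSelections P 𝒢 X) :=
  (isClosed_aestronglyMeasurable h𝒢).inter (isClosed_setOf_ae hX)

theorem IsDecomposable.exists_piecewise_mem (h𝒢 : 𝒢 ≤ mΩ) (hV : IsDecomposable 𝒢 V)
    {f g : Lp (Vec d) 2 P} (hf : f ∈ V) (hg : g ∈ V) {D : Set Ω} (hD : MeasurableSet[𝒢] D) :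
    ∃ w ∈ V, w =ᵐ[P] fun ω => D.indicator f ω + Dᶜ.indicator g ω := by
  have hL : MemLp (fun ω => D.indicator f ω + Dᶜ.indicator g ω) 2 P :=
    ((Lp.memLp f).indicator (h𝒢 _ hD)).add ((Lp.memLp g).indicator (h𝒢 _ hD.compl))
  exact ⟨hL.toLp _, hV f hf g hg D hD _ hL.coeFn_toLp, hL.coeFn_toLp⟩

/-- Paste `f` and `g` along the event where `f` is at least as close to `h`; representatives
measurable for `𝒢` put this event in `𝒢`. -/
theorem IsDecomposable.exists_edist_eq_min (h𝒢 : 𝒢 ≤ mΩ) (hV : IsDecomposable 𝒢 V)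
    (hm : ∀ f ∈ V, AEStronglyMeasurable[𝒢] f P) {f g : Lp (Vec d) 2 P} (hf : f ∈ V) (hg : g ∈ V)
    {h : Ω → Vec d} (hh : AEStronglyMeasurable[𝒢] h P) :
    ∃ w ∈ V, ∀ᵐ ω ∂P, edist (w ω) (h ω) = min (edist (f ω) (h ω)) (edist (g ω) (h ω)) := by
  obtain ⟨f', hf', hff'⟩ := hm f hf
  obtain ⟨g', hg', hgg'⟩ := hm g hg
  obtain ⟨h', hh', hhh'⟩ := hh
  have hD : MeasurableSet[𝒢] {ω | edist (f' ω) (h' ω) ≤ edist (g' ω) (h' ω)} :=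
    measurableSet_edist_le hf'.measurable hg'.measurable hh'.measurable
  obtain ⟨w, hw, hwe⟩ := hV.exists_piecewise_mem h𝒢 hf hg hD
  refine ⟨w, hw, ?_⟩
  filter_upwards [hwe, hff', hgg', hhh'] with ω h1 h2 h3 h4
  rw [h1, h2, h3, h4]
  by_cases hω : edist (f' ω) (h' ω) ≤ edist (g' ω) (h' ω)
  · simp [indicator, hω, h2]
  · simp [indicator, hω, h3, (not_le.1 hω).le]

theorem lintegral_edist_sq_ne_top (f h : Lp (Vec d) 2 P) :
    ∫⁻ ω, edist (f ω) (h ω) ^ 2 ∂P ≠ ∞ := by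
  simp_rw [edist_eq_enorm_sub]
  exact ((memLp_two_iff_lintegral ((Lp.memLp f).sub (Lp.memLp h)).1).1
    ((Lp.memLp f).sub (Lp.memLp h))).ne

theorem aemeasurable_edist_sq (f h : Lp (Vec d) 2 P) :
    AEMeasurable (fun ω => edist (f ω) (h ω) ^ 2) P :=
  ((Lp.aestronglyMeasurable f).aemeasurable.edist
    (Lp.aestronglyMeasurable h).aemeasurable).pow_const 2

/-- A decomposable set contains a sequence realising the essential infimum of the distance of its
elements to a given function. -/
theorem IsDecomposable.exists_minimizing_seq (h𝒢 : 𝒢 ≤ mΩ) (hV : IsDecomposable 𝒢 V)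
    (hm : ∀ f ∈ V, AEStronglyMeasurable[𝒢] f P) (hne : V.Nonempty) {h : Lp (Vec d) 2 P}
    (hh : AEStronglyMeasurable[𝒢] h P) :
    ∃ u : ℕ → Lp (Vec d) 2 P, (∀ j, u j ∈ V) ∧
      ∀ f ∈ V, ∀ᵐ ω ∂P, (⨅ j, edist (u j ω) (h ω)) ≤ edist (f ω) (h ω) := by
  set J : Lp (Vec d) 2 P → ℝ≥0∞ := fun v => ∫⁻ ω, edist (v ω) (h ω) ^ 2 ∂P
  -- Near-minimizers of the squared distance to `h`; the infimum is finite, so the positive slack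
  -- makes the inequality strict.
  have hmin : ∀ j : ℕ, ∃ v ∈ V, ∀ w ∈ V, J v ≤ J w + ((j : ℝ≥0∞) + 1)⁻¹ := by
    intro j
    obtain ⟨v₀, hv₀⟩ := hne
    have hlt : (⨅ w ∈ V, J w) < (⨅ w ∈ V, J w) + ((j : ℝ≥0∞) + 1)⁻¹ := by
      refine ENNReal.lt_add_right
        (ne_top_of_le_ne_top (lintegral_edist_sq_ne_top v₀ h) (iInf₂_le v₀ hv₀)) ?_
      simp
    simp only [iInf_lt_iff] at hlt
    obtain ⟨v, hv, hlt⟩ := hlt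
    exact ⟨v, hv, fun w hw => hlt.le.trans (by gcongr; exact iInf₂_le w hw)⟩
  choose u huV hu using hmin
  refine ⟨u, huV, fun f hf => ?_⟩
  -- Pasting the competitor `f` into `u j` gives `w j ∈ V`, which can gain at most `1/(j+1)` over `u
  -- j` in integral.
  choose w hwV hw using fun j => hV.exists_edist_eq_min h𝒢 hm (huV j) hf hh
  have hwle : ∀ j, (fun ω => edist (w j ω) (h ω) ^ 2) ≤ᵐ[P] fun ω => edist (u j ω) (h ω) ^ 2 := by
    intro j
    filter_upwards [hw j] with ω hω
    rw [hω]
    gcongr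
    exact min_le_left _ _
  have hint : ∀ j, ∫⁻ ω, (edist (u j ω) (h ω) ^ 2 - edist (w j ω) (h ω) ^ 2) ∂P
      ≤ ((j : ℝ≥0∞) + 1)⁻¹ := by
    intro j
    rw [lintegral_sub' (aemeasurable_edist_sq _ _) (lintegral_edist_sq_ne_top _ _) (hwle j)]
    exact tsub_le_iff_left.2 (hu j _ (hwV j))
  have hzero : ∫⁻ ω, ⨅ j, (edist (u j ω) (h ω) ^ 2 - edist (w j ω) (h ω) ^ 2) ∂P = 0 := by
    refine le_antisymm (ge_of_tendsto' (ENNReal.tendsto_inv_nat_nhds_zero.comp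
      (Filter.tendsto_add_atTop_nat 1)) fun j => ?_) bot_le
    refine (lintegral_mono fun ω => iInf_le _ j).trans ((hint j).trans_eq ?_)
    simp
  replace hzero := (lintegral_eq_zero_iff' (AEMeasurable.iInf fun j =>
    (aemeasurable_edist_sq (u j) h).sub (aemeasurable_edist_sq (w j) h))).1 hzero
  filter_upwards [hzero, ae_all_iff.2 hw] with ω h0 hwω
  by_contra! hcon
  -- Where `f` strictly beats the infimum, this gap is a positive lower bound, uniform in `j`, for a
  -- gain whose infimum over `j` vanishes a.e.
  have hpos : 0 < (⨅ j, edist (u j ω) (h ω)) ^ 2 - edist (f ω) (h ω) ^ 2 :=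
    tsub_pos_of_lt (ENNReal.pow_lt_pow_left two_ne_zero hcon)
  refine (hpos.trans_le ?_).ne' h0
  refine le_iInf fun j => ?_
  rw [Pi.sub_apply, hwω j, min_eq_right (hcon.le.trans (iInf_le _ j))]
  gcongr
  exact iInf_le _ j

/-- An `L²` function lying pointwise in the closure of a sequence of elements of a decomposable set
lies in the `L²`-closure of this set. -/
theorem IsDecomposable.mem_closure_of_ae_mem_closure_range (h𝒢 : 𝒢 ≤ mΩ) (hV : IsDecomposable 𝒢 V)
    (hm : ∀ f ∈ V, AEStronglyMeasurable[𝒢] f P) {v : ℕ → Lp (Vec d) 2 P} (hv : ∀ i, v i ∈ V)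
    {f : Lp (Vec d) 2 P} (hfm : AEStronglyMeasurable[𝒢] f P)
    (hf : ∀ᵐ ω ∂P, f ω ∈ closure (range fun i => v i ω)) : f ∈ closure V := by
  -- `w n` pastes together `v 0, …, v n`, choosing at each `ω` the one closest to `f`. The distance
  -- to `v 0` then dominates.
  have hw : ∀ n : ℕ, ∃ w ∈ V, ∀ᵐ ω ∂P, ∀ i ≤ n, edist (w ω) (f ω) ≤ edist (v i ω) (f ω) := by
    intro n
    induction n with
    | zero => exact ⟨v 0, hv 0, ae_of_all _ fun ω i hi => by rw [Nat.le_zero.1 hi]⟩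
    | succ n ih =>
      obtain ⟨w, hwV, hw⟩ := ih
      obtain ⟨w', hwV', hw'⟩ := hV.exists_edist_eq_min h𝒢 hm hwV (hv (n + 1)) hfm
      refine ⟨w', hwV', ?_⟩
      filter_upwards [hw, hw'] with ω h1 h2 i hi
      rw [h2]
      rcases Nat.le_succ_iff.1 hi with hi | rfl
      · exact (min_le_left _ _).trans (h1 i hi)
      · exact min_le_right _ _
  choose w hwV hw using hw
  refine mem_closure_of_tendsto (b := Filter.atTop) (f := w) ?_ (Filter.Eventually.of_forall hwV)
  rw [Lp.tendsto_Lp_iff_tendsto_eLpNorm']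
  have hsq : Filter.Tendsto (fun n => ∫⁻ ω, edist (w n ω) (f ω) ^ 2 ∂P) Filter.atTop (nhds 0) := by
    have := tendsto_lintegral_of_dominated_convergence' (μ := P)
      (F := fun n ω => edist (w n ω) (f ω) ^ 2) (f := fun _ => 0)
      (fun ω => edist (v 0 ω) (f ω) ^ 2) (fun n => aemeasurable_edist_sq _ _) (fun n => ?_)
      (lintegral_edist_sq_ne_top _ _) ?_
    · simpa using this
    · filter_upwards [hw n] with ω hω
      have := hω 0 (Nat.zero_le n)
      gcongr
    · filter_upwards [hf, ae_all_iff.2 hw] with ω h1 h2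
      have : Filter.Tendsto (fun n => edist (w n ω) (f ω)) Filter.atTop (nhds 0) := by
        rw [ENNReal.tendsto_atTop_zero]
        intro ε hε
        rw [EMetric.mem_closure_iff] at h1
        obtain ⟨_, ⟨i, rfl⟩, hi⟩ := h1 ε hε
        refine ⟨i, fun n hn => (h2 n i hn).trans ?_⟩
        rw [edist_comm]
        exact hi.le
      simpa using ENNReal.Tendsto.pow (n := 2) this
  have := (ENNReal.continuous_rpow_const (y := 1 / 2)).tendsto 0 |>.comp hsq
  simp only [one_div, inv_pos, Nat.ofNat_pos, ENNReal.zero_rpow_of_pos] at this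
  refine this.congr fun n => ?_
  simp only [Function.comp_apply, edist_eq_enorm_sub]
  have h2 := eLpNorm_two_sq (⇑(w n) - ⇑f) P
  simp only [Pi.sub_apply] at h2
  rw [← h2, ← ENNReal.rpow_natCast, ← ENNReal.rpow_mul]
  norm_num

/-- **Hiai–Umegaki**: the closure of a nonempty decomposable set of square-integrable
`𝒢`-measurable functions is the set of square-integrable selections of a random closed set. -/
theorem IsDecomposable.exists_sqSelections_eq_closure [IsProbabilityMeasure P] (h𝒢 : 𝒢 ≤ mΩ)
    (hV : IsDecomposable 𝒢 V) (hm : ∀ f ∈ V, AEStronglyMeasurable[𝒢] f P) (hne : V.Nonempty) :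
    ∃ X : Ω → Set (Vec d), (∀ ω, (X ω).Nonempty) ∧ (∀ ω, IsClosed (X ω)) ∧
      SetValuedMeasurable 𝒢 X ∧ sqSelections P 𝒢 X = closure V := by
  set q := TopologicalSpace.denseSeq (Vec d)
  have hqL : ∀ k, MemLp (fun _ : Ω => q k) 2 P := fun k => memLp_const _
  have hqm : ∀ k, AEStronglyMeasurable[𝒢] ((hqL k).toLp _) P := fun k =>
    ⟨fun _ => q k, stronglyMeasurable_const, (hqL k).coeFn_toLp⟩
  choose u huV hu using fun k => hV.exists_minimizing_seq h𝒢 hm hne (hqm k)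
  -- One enumeration of the minimizing sequences for all centres `q k`; the closure of its pointwise
  -- values is the random set.
  set v : ℕ → Lp (Vec d) 2 P := fun i => u i.unpair.1 i.unpair.2 with hvdef
  have hvV : ∀ i, v i ∈ V := fun i => huV _ _
  choose v' hv' hvv' using fun i => hm (v i) (hvV i)
  refine ⟨fun ω => closure (range fun i => v' i ω), fun ω => (range_nonempty _).closure,
    fun ω => isClosed_closure, setValuedMeasurable_closure_range fun i => (hv' i).measurable, ?_⟩
  have hcl : ∀ᵐ ω ∂P, closure (range fun i => v' i ω) = closure (range fun i => v i ω) := by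
    filter_upwards [ae_all_iff.2 hvv'] with ω hω
    simp_rw [hω]
  apply Subset.antisymm
  · rintro f ⟨hfm, hf⟩
    refine hV.mem_closure_of_ae_mem_closure_range h𝒢 hm hvV hfm ?_
    filter_upwards [hf, hcl] with ω h1 h2
    rwa [← h2]
  · refine closure_minimal (fun f hf => ⟨hm f hf, ?_⟩)
      (isClosed_sqSelections h𝒢 fun ω => isClosed_closure)
    filter_upwards [hcl, ae_all_iff.2 fun k => hu k f hf,
      ae_all_iff.2 fun k => (hqL k).coeFn_toLp] with ω h1 h2 h3
    rw [h1, EMetric.mem_closure_iff]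
    intro ε hε
    obtain ⟨_, ⟨k, rfl⟩, hk⟩ := EMetric.mem_closure_iff.1
      (TopologicalSpace.denseRange_denseSeq (Vec d) (f ω)) (ε / 2) (ENNReal.half_pos hε.ne')
    -- As `f ω` is within `ε / 2` of `q k`, so is some `u k j ω`, by minimality of that sequence.
    have hlt : (⨅ j, edist (u k j ω) (q k)) < ε / 2 := by
      have := h2 k
      rw [h3 k] at this
      exact this.trans_lt hk
    obtain ⟨j, hj⟩ := iInf_lt_iff.1 hlt
    refine ⟨_, ⟨Nat.pair k j, rfl⟩, ?_⟩
    simp only [hvdef, Nat.unpair_pair]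
    calc edist (f ω) (u k j ω) ≤ edist (f ω) (q k) + edist (u k j ω) (q k) :=
          edist_triangle_right _ _ _
      _ < ε / 2 + ε / 2 := ENNReal.add_lt_add hk hj
      _ = ε := ENNReal.add_halves ε

end Decomposable

/-! ### Square-integrable selections exhaust a random closed set -/

section Castaing

variable {d : ℕ} {Ω : Type*} {𝒢 : MeasurableSpace Ω} {mΩ : MeasurableSpace Ω} {P : Measure Ω}

/-- A closed condition satisfied a.s. by all square-integrable selections of a random closed set
is a.s. satisfied on the whole set. -/
theorem ae_forall_mem_of_sqSelections_subset [IsFiniteMeasure P] (h𝒢 : 𝒢 ≤ mΩ)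
    {X : Ω → Set (Vec d)} (hX : SetValuedMeasurable 𝒢 X) (hc : ∀ ω, IsClosed (X ω))
    (hne : ∀ ω, (X ω).Nonempty) (hS : (sqSelections P 𝒢 X).Nonempty) {p : Ω → Vec d → Prop}
    (hp : ∀ ω, IsClosed {x | p ω x}) (h : ∀ f ∈ sqSelections P 𝒢 X, ∀ᵐ ω ∂P, p ω (f ω)) :
    ∀ᵐ ω ∂P, ∀ x ∈ X ω, p ω x := by
  obtain ⟨g, ⟨g', hg', hgg'⟩, hgX⟩ := hS
  have hg'L : MemLp g' 2 P := (memLp_congr_ae hgg').1 (Lp.memLp g)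
  set q := TopologicalSpace.denseSeq (Vec d)
  set φ : ℕ → Ω → Vec d := fun k ω => nearest (q k) (X ω) with hφ
  have hφm : ∀ k, Measurable[𝒢] (φ k) := fun k => hX.measurable_nearest hc hne measurable_const
  have hD : ∀ k n : ℕ, MeasurableSet[𝒢] {ω | ‖φ k ω‖ ≤ n} := fun k n =>
    hφm k (measurableSet_le (measurable_norm (α := Vec d)) measurable_const)
  -- The projections `φ k` of a dense sequence are dense in `X` but need not be square-integrable.
  -- Where `φ k` exceeds `n`, it is replaced by the given selection; each `φ k ω` is recovered for
  -- `n` large.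
  set ψ : ℕ → ℕ → Ω → Vec d := fun k n ω =>
    {ω | ‖φ k ω‖ ≤ n}.indicator (φ k) ω + {ω | ‖φ k ω‖ ≤ n}ᶜ.indicator g' ω with hψ
  have hψm : ∀ k n, StronglyMeasurable[𝒢] (ψ k n) := fun k n =>
    ((hφm k).stronglyMeasurable.indicator (hD k n)).add (hg'.indicator (hD k n).compl)
  have hψL : ∀ k n, MemLp (ψ k n) 2 P := by
    intro k n
    refine MemLp.add (MemLp.of_bound
      (((hφm k).stronglyMeasurable.indicator (hD k n)).mono h𝒢).aestronglyMeasurable n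
      (ae_of_all _ fun ω => ?_)) (hg'L.indicator (h𝒢 _ (hD k n).compl))
    by_cases hω : ‖φ k ω‖ ≤ n <;> simp [indicator, hω]
  have hψp : ∀ k n, ∀ᵐ ω ∂P, p ω (ψ k n ω) := by
    intro k n
    have hmem : (hψL k n).toLp _ ∈ sqSelections P 𝒢 X := by
      refine ⟨⟨ψ k n, hψm k n, (hψL k n).coeFn_toLp⟩, ?_⟩
      filter_upwards [(hψL k n).coeFn_toLp, hgX, hgg'] with ω h1 h2 h3
      rw [h1]
      by_cases hω : ‖φ k ω‖ ≤ n
      · simpa [hψ, indicator, hω, not_lt.2 hω] using nearest_mem (q k) (hc ω) (hne ω)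
      · simpa [hψ, indicator, hω, not_le.1 hω, ← h3] using h2
    filter_upwards [h _ hmem, (hψL k n).coeFn_toLp] with ω h1 h2
    rwa [← h2]
  filter_upwards [ae_all_iff.2 fun k => ae_all_iff.2 (hψp k)] with ω hω x hx
  have hφp : ∀ k, p ω (φ k ω) := by
    intro k
    obtain ⟨n, hn⟩ := exists_nat_ge ‖φ k ω‖
    simpa [hψ, indicator, hn, not_lt.2 hn] using hω k n
  have hmem : x ∈ closure {x | p ω x} := by
    rw [EMetric.mem_closure_iff]
    intro ε hε
    obtain ⟨_, ⟨k, rfl⟩, hk⟩ := EMetric.mem_closure_iff.1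
      (TopologicalSpace.denseRange_denseSeq (Vec d) x) (ε / 2) (ENNReal.half_pos hε.ne')
    refine ⟨φ k ω, hφp k, ?_⟩
    have h1 : edist (q k) (φ k ω) < ε / 2 := by
      rw [hφ, edist_nearest _ (hc ω) (hne ω)]
      exact (Metric.infEDist_le_edist_of_mem hx).trans_lt (by rwa [edist_comm])
    calc edist x (φ k ω) ≤ edist x (q k) + edist (q k) (φ k ω) := edist_triangle _ _ _
      _ < ε / 2 + ε / 2 := ENNReal.add_lt_add hk h1
      _ = ε := ENNReal.add_halves ε
  rwa [(hp ω).closure_eq] at hmem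

end Castaing

/-! ### Time integrals -/

section Time

variable {d : ℕ} {T : ℝ} {Ω : Type*} {mΩ : MeasurableSpace Ω}

theorem timeMeasure_Ici (t : Icc (0 : ℝ) T) : timeMeasure T (Ici t) = ENNReal.ofReal (T - t) := by
  have himg : Subtype.val '' Ici t = Icc (t : ℝ) T := by
    ext x
    constructor
    · rintro ⟨y, hy, rfl⟩
      exact ⟨hy, y.2.2⟩
    · rintro ⟨h1, h2⟩
      exact ⟨⟨x, t.2.1.trans h1, h2⟩, h1, rfl⟩
  rw [timeMeasure, (MeasurableEmbedding.subtype_coe measurableSet_Icc).comap_apply, himg,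
    Real.volume_Icc]

instance isFiniteMeasure_timeMeasure (T : ℝ) : IsFiniteMeasure (timeMeasure T) := by
  constructor
  rw [timeMeasure, (MeasurableEmbedding.subtype_coe measurableSet_Icc).comap_apply, image_univ,
    Subtype.range_coe, Real.volume_Icc]
  exact ENNReal.ofReal_lt_top

/-- Cauchy–Schwarz on `[t, T]`, whose length is the factor `T - t`. -/
theorem enorm_setIntegral_sq_le (t : Icc (0 : ℝ) T) {f : Icc (0 : ℝ) T → Vec d}
    (hf : AEStronglyMeasurable f ((timeMeasure T).restrict (Ici t))) :
    ‖∫ s in Ici t, f s ∂(timeMeasure T)‖ₑ ^ 2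
      ≤ ENNReal.ofReal (T - t) * ∫⁻ s in Ici t, ‖f s‖ₑ ^ 2 ∂(timeMeasure T) := by
  have h1 : ‖∫ s in Ici t, f s ∂(timeMeasure T)‖ₑ
      ≤ eLpNorm f 2 ((timeMeasure T).restrict (Ici t)) * ENNReal.ofReal (T - t) ^ (1 / 2 : ℝ) := by
    refine (enorm_integral_le_lintegral_enorm _).trans ?_
    rw [← eLpNorm_one_eq_lintegral_enorm]
    refine (eLpNorm_le_eLpNorm_mul_rpow_measure_univ one_le_two hf).trans_eq ?_
    rw [Measure.restrict_apply_univ, timeMeasure_Ici]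
    norm_num
  calc _ ≤ (eLpNorm f 2 ((timeMeasure T).restrict (Ici t))
        * ENNReal.ofReal (T - t) ^ (1 / 2 : ℝ)) ^ 2 := by gcongr
    _ = _ := by
      rw [mul_pow, eLpNorm_two_sq, mul_comm, ← ENNReal.rpow_natCast, ← ENNReal.rpow_mul]
      norm_num

theorem hausdorffEDist_singleton_zero_eq {A : Set (Vec d)} (hne : A.Nonempty) :
    Metric.hausdorffEDist A {0} = ⨆ x ∈ A, ‖x‖ₑ := by
  apply le_antisymm
  · refine Metric.hausdorffEDist_le_of_infEDist (fun x hx => ?_) fun y hy => ?_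
    · rw [Metric.infEDist_singleton, edist_zero_right]
      exact le_iSup₂_of_le x hx le_rfl
    · obtain ⟨x, hx⟩ := hne
      rw [mem_singleton_iff.1 hy]
      refine (Metric.infEDist_le_edist_of_mem hx).trans ?_
      rw [edist_zero_left]
      exact le_iSup₂_of_le x hx le_rfl
  · refine iSup₂_le fun x hx => ?_
    simpa using Metric.infEDist_le_hausdorffEDist_of_mem (t := {(0 : Vec d)}) hx

/-- By compactness the largest norm is attained, so it is at least `r` exactly when the set hits the
closed set `‖x‖ ≥ r`. -/
theorem SetValuedMeasurable.measurable_hausdorffEDist_zero {α : Type*} {m : MeasurableSpace α}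
    {F : α → Set (Vec d)} (hF : SetValuedMeasurable m F) (hc : ∀ a, IsCompact (F a))
    (hne : ∀ a, (F a).Nonempty) : Measurable fun a => Metric.hausdorffEDist (F a) {0} := by
  refine measurable_of_Ici fun r => ?_
  have : (fun a => Metric.hausdorffEDist (F a) {0}) ⁻¹' Ici r
      = {a | (F a ∩ {x | r ≤ ‖x‖ₑ}).Nonempty} := by
    ext a
    rw [mem_preimage, hausdorffEDist_singleton_zero_eq (hne a)]
    constructor
    · intro h
      obtain ⟨x, hx, hmax⟩ := (hc a).exists_isMaxOn (hne a) (continuous_enorm (E := Vec d)).continuousOn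
      exact ⟨x, hx, mem_ofPred.2 ((mem_Ici.1 h).trans (iSup₂_le fun y hy => hmax hy))⟩
    · rintro ⟨x, hx, hr⟩
      exact mem_Ici.2 (le_iSup₂_of_le x hx (mem_ofPred.1 hr))
  rw [this]
  exact hF _ (isClosed_le continuous_const continuous_enorm)

variable {ℱ : Filtration (Icc (0 : ℝ) T) mΩ} {P : Measure Ω}
  {Φ Ψ : Icc (0 : ℝ) T → Ω → Set (Vec d)}

theorem SetValuedMeasurable.comp {α β : Type*} {mα : MeasurableSpace α} {mβ : MeasurableSpace β}
    {F : β → Set (Vec d)} (hF : SetValuedMeasurable mβ F) {g : α → β} (hg : Measurable g) :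
    SetValuedMeasurable mα fun a => F (g a) :=
  fun B hB => hg (hF B hB)

/-- The identification of `[0,T] × Ω` with its part up to the terminal time is measurable. -/
theorem measurable_restrict_terminal (hT : 0 < T) (𝒢 : MeasurableSpace Ω) :
    Measurable fun p : Icc (0 : ℝ) T × Ω =>
      ((⟨p.1, p.1.2.2⟩ : Iic (⟨T, right_mem_Icc.2 hT.le⟩ : Icc (0 : ℝ) T)), p.2) :=
  (measurable_fst.subtype_mk).prodMk measurable_snd

theorem SetValuedProgMeasurable.terminal (hT : 0 < T) (h : SetValuedProgMeasurable ℱ Φ) :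
    SetValuedMeasurable (@Prod.instMeasurableSpace (Icc (0 : ℝ) T) Ω _ (terminalSigma hT ℱ))
      fun p : Icc (0 : ℝ) T × Ω => Φ p.1 p.2 :=
  SetValuedMeasurable.comp (mα := @Prod.instMeasurableSpace _ Ω _ (terminalSigma hT ℱ))
    (mβ := @Prod.instMeasurableSpace _ Ω _ (terminalSigma hT ℱ))
    (h ⟨T, right_mem_Icc.2 hT.le⟩) (measurable_restrict_terminal hT (terminalSigma hT ℱ))

theorem stronglyMeasurable_terminal (hT : 0 < T) {φ : Icc (0 : ℝ) T → Ω → Vec d}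
    (h : IsStronglyProgressive ℱ φ) :
    StronglyMeasurable[@Prod.instMeasurableSpace (Icc (0 : ℝ) T) Ω _ (terminalSigma hT ℱ)]
      fun p : Icc (0 : ℝ) T × Ω => φ p.1 p.2 :=
  StronglyMeasurable.comp_measurable (h ⟨T, right_mem_Icc.2 hT.le⟩)
    (measurable_restrict_terminal hT (terminalSigma hT ℱ))

theorem prod_terminalSigma_le (hT : 0 < T) (ℱ : Filtration (Icc (0 : ℝ) T) mΩ) :
    @Prod.instMeasurableSpace (Icc (0 : ℝ) T) Ω _ (terminalSigma hT ℱ)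
      ≤ @Prod.instMeasurableSpace (Icc (0 : ℝ) T) Ω _ mΩ :=
  sup_le_sup_left (MeasurableSpace.comap_mono (ℱ.le _)) _

end Time

/-! ### Selections of processes, existence of the integral, and the one-sided estimate -/

section SetTimeIntegral

variable {d : ℕ} {T : ℝ} {Ω : Type*} {mΩ : MeasurableSpace Ω}
  {ℱ : Filtration (Icc (0 : ℝ) T) mΩ} {P : Measure Ω}
  {Φ Ψ : Icc (0 : ℝ) T → Ω → Set (Vec d)} {φ ψ : Icc (0 : ℝ) T → Ω → Vec d}

theorem aestronglyMeasurable_of_isStronglyProgressive (hT : 0 < T) (hφ : IsStronglyProgressive ℱ φ) :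
    AEStronglyMeasurable (fun p : Icc (0 : ℝ) T × Ω => φ p.1 p.2) ((timeMeasure T).prod P) :=
  ((stronglyMeasurable_terminal hT hφ).mono (prod_terminalSigma_le hT ℱ)).aestronglyMeasurable

theorem stronglyMeasurable_section (hT : 0 < T) (hφ : IsStronglyProgressive ℱ φ) (ω : Ω) :
    StronglyMeasurable fun s => φ s ω :=
  ((stronglyMeasurable_terminal hT hφ).mono (prod_terminalSigma_le hT ℱ)).comp_measurable
    measurable_prodMk_right

theorem stronglyMeasurable_setIntegral (hT : 0 < T) (hφ : IsStronglyProgressive ℱ φ)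
    (t : Icc (0 : ℝ) T) :
    StronglyMeasurable[terminalSigma hT ℱ] fun ω => ∫ s in Ici t, φ s ω ∂(timeMeasure T) :=
  @StronglyMeasurable.integral_prod_left' _ _ _ _ (terminalSigma hT ℱ) _ _ _ _ _
    (stronglyMeasurable_terminal hT hφ)

theorem memLp_setIntegral [SFinite P] (hT : 0 < T) (hφ : IsStronglyProgressive ℱ φ)
    (hL : MemLp (fun p : Icc (0 : ℝ) T × Ω => φ p.1 p.2) 2 ((timeMeasure T).prod P))
    (t : Icc (0 : ℝ) T) :
    MemLp (fun ω => ∫ s in Ici t, φ s ω ∂(timeMeasure T)) 2 P := by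
  rw [memLp_two_iff_lintegral
    ((stronglyMeasurable_setIntegral hT hφ t).mono (ℱ.le _)).aestronglyMeasurable]
  have hfin := (memLp_two_iff_lintegral hL.1).1 hL
  rw [lintegral_prod_symm _ (hL.1.enorm.pow_const 2)] at hfin
  calc ∫⁻ ω, ‖∫ s in Ici t, φ s ω ∂(timeMeasure T)‖ₑ ^ 2 ∂P
      ≤ ∫⁻ ω, ENNReal.ofReal (T - t) * ∫⁻ s, ‖φ s ω‖ₑ ^ 2 ∂(timeMeasure T) ∂P := by
        refine lintegral_mono fun ω => (enorm_setIntegral_sq_le t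
          (stronglyMeasurable_section hT hφ ω).aestronglyMeasurable).trans ?_
        gcongr
        exact Measure.restrict_le_self
    _ = ENNReal.ofReal (T - t) * ∫⁻ ω, ∫⁻ s, ‖φ s ω‖ₑ ^ 2 ∂(timeMeasure T) ∂P :=
        lintegral_const_mul' _ _ ENNReal.ofReal_ne_top
    _ < ∞ := ENNReal.mul_lt_top ENNReal.ofReal_lt_top hfin

theorem ae_ae_swap {α β : Type*} {mα : MeasurableSpace α} {mβ : MeasurableSpace β} {μ : Measure α}
    {ν : Measure β} [SFinite μ] [SFinite ν] {p : α × β → Prop} (h : ∀ᵐ z ∂μ.prod ν, p z) :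
    ∀ᵐ b ∂ν, ∀ᵐ a ∂μ, p (a, b) :=
  Measure.ae_ae_of_ae_prod (p := fun z : β × α => p z.swap)
    (Measure.measurePreserving_swap.quasiMeasurePreserving.ae h)

theorem ae_integrable_section [SFinite P]
    (hL : MemLp (fun p : Icc (0 : ℝ) T × Ω => φ p.1 p.2) 2 ((timeMeasure T).prod P))
    (hφ : ∀ ω, StronglyMeasurable fun s => φ s ω) :
    ∀ᵐ ω ∂P, Integrable (fun s => φ s ω) (timeMeasure T) := by
  have hfin := (memLp_two_iff_lintegral hL.1).1 hL
  rw [lintegral_prod_symm _ (hL.1.enorm.pow_const 2)] at hfin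
  have hm : AEMeasurable (fun ω => ∫⁻ s, ‖φ s ω‖ₑ ^ 2 ∂(timeMeasure T)) P :=
    (hL.1.enorm.pow_const 2).lintegral_prod_left'
  filter_upwards [ae_lt_top' hm hfin.ne] with ω hω
  exact ((memLp_two_iff_lintegral (hφ ω).aestronglyMeasurable).2 hω).integrable one_le_two

namespace IsSquareIntegrablyBounded

theorem isClosed (hΦ : IsSquareIntegrablyBounded ℱ P Φ) (s : Icc (0 : ℝ) T) (ω : Ω) :
    IsClosed (Φ s ω) :=
  (hΦ.isConvexBody s ω).2.1.isClosed

theorem nonempty (hΦ : IsSquareIntegrablyBounded ℱ P Φ) (s : Icc (0 : ℝ) T) (ω : Ω) :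
    (Φ s ω).Nonempty :=
  (hΦ.isConvexBody s ω).1

theorem measurable_hausdorffEDist (hT : 0 < T) (hΦ : IsSquareIntegrablyBounded ℱ P Φ) :
    Measurable fun p : Icc (0 : ℝ) T × Ω => Metric.hausdorffEDist (Φ p.1 p.2) {0} :=
  (SetValuedMeasurable.measurable_hausdorffEDist_zero
    (m := @Prod.instMeasurableSpace _ Ω _ (terminalSigma hT ℱ)) (hΦ.progMeasurable.terminal hT)
    (fun p => (hΦ.isConvexBody p.1 p.2).2.1) fun p => hΦ.nonempty p.1 p.2).mono
    (prod_terminalSigma_le hT ℱ) le_rfl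

/-- Projection preserves measurability on each `[0, i] × Ω`, and the norm of the result is at most
`h(Φ, {0})`. -/
theorem nearest_mem_progSelections [SFinite P] (hT : 0 < T) (hΦ : IsSquareIntegrablyBounded ℱ P Φ)
    (hφ : IsStronglyProgressive ℱ φ) :
    (fun s ω => nearest (φ s ω) (Φ s ω)) ∈ progSelections ℱ P Φ := by
  have hprog : IsStronglyProgressive ℱ fun s ω => nearest (φ s ω) (Φ s ω) := by
    intro i
    have := SetValuedMeasurable.measurable_nearest
      (m := @Prod.instMeasurableSpace (Iic i) Ω Subtype.instMeasurableSpace (ℱ i))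
      (hΦ.progMeasurable i) (fun p => hΦ.isClosed p.1 p.2) (fun p => hΦ.nonempty p.1 p.2)
      (hφ i).measurable
    exact this.stronglyMeasurable
  have hm := aestronglyMeasurable_of_isStronglyProgressive (P := P) hT hprog
  have hmem : ∀ s ω, nearest (φ s ω) (Φ s ω) ∈ Φ s ω := fun s ω =>
    nearest_mem _ (hΦ.isClosed s ω) (hΦ.nonempty s ω)
  refine ⟨hprog, (memLp_two_iff_lintegral hm).2 ?_, ae_of_all _ fun p => hmem p.1 p.2⟩
  have hle : ∀ s ω, ‖nearest (φ s ω) (Φ s ω)‖ₑ ≤ Metric.hausdorffEDist (Φ s ω) {0} := by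
    intro s ω
    rw [hausdorffEDist_singleton_zero_eq (hΦ.nonempty s ω)]
    exact le_iSup₂_of_le _ (hmem s ω) le_rfl
  rw [lintegral_prod_symm _ (hm.enorm.pow_const 2)]
  refine lt_of_le_of_lt (lintegral_mono fun ω => lintegral_mono fun s => ?_) hΦ.bounded
  have := hle s ω
  gcongr

theorem progSelections_nonempty [SFinite P] (hT : 0 < T) (hΦ : IsSquareIntegrablyBounded ℱ P Φ) :
    (progSelections ℱ P Φ).Nonempty :=
  ⟨_, hΦ.nearest_mem_progSelections hT (isStronglyProgressive_const ℱ 0)⟩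

/-- Compare both sets with `{0}` and use `(a + b)² ≤ 2(a² + b²)`. Only the two norms need to be
measurable. -/
theorem ae_lintegral_hausdorffEDist_lt_top (hT : 0 < T)
    (hΦ : IsSquareIntegrablyBounded ℱ P Φ) (hΨ : IsSquareIntegrablyBounded ℱ P Ψ) :
    ∀ᵐ ω ∂P, ∫⁻ s, Metric.hausdorffEDist (Φ s ω) (Ψ s ω) ^ 2 ∂(timeMeasure T) < ∞ := by
  have hm := fun (Θ : Icc (0 : ℝ) T → Ω → Set (Vec d)) (h : IsSquareIntegrablyBounded ℱ P Θ) =>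
    ((h.measurable_hausdorffEDist hT).pow_const 2)
  filter_upwards [ae_lt_top (hm Φ hΦ).lintegral_prod_left' hΦ.bounded.ne,
    ae_lt_top (hm Ψ hΨ).lintegral_prod_left' hΨ.bounded.ne] with ω h1 h2
  calc ∫⁻ s, Metric.hausdorffEDist (Φ s ω) (Ψ s ω) ^ 2 ∂(timeMeasure T)
      ≤ ∫⁻ s, 2 * (Metric.hausdorffEDist (Φ s ω) {0} ^ 2
          + Metric.hausdorffEDist (Ψ s ω) {0} ^ 2) ∂(timeMeasure T) := by
        refine lintegral_mono fun s => ?_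
        have htri : Metric.hausdorffEDist (Φ s ω) (Ψ s ω)
            ≤ Metric.hausdorffEDist (Φ s ω) {0} + Metric.hausdorffEDist (Ψ s ω) {0} := by
          rw [Metric.hausdorffEDist_comm (s := Ψ s ω)]
          exact Metric.hausdorffEDist_triangle
        refine (pow_le_pow_left₀ bot_le htri 2).trans ?_
        have := ENNReal.rpow_add_le_mul_rpow_add_rpow (Metric.hausdorffEDist (Φ s ω) {0})
          (Metric.hausdorffEDist (Ψ s ω) {0}) (p := 2) one_le_two
        norm_num at this
        exact this
    _ = 2 * (∫⁻ s, Metric.hausdorffEDist (Φ s ω) {0} ^ 2 ∂(timeMeasure T)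
          + ∫⁻ s, Metric.hausdorffEDist (Ψ s ω) {0} ^ 2 ∂(timeMeasure T)) := by
        have hsec : Measurable fun s => Metric.hausdorffEDist (Φ s ω) {0} ^ 2 :=
          (hm Φ hΦ).comp measurable_prodMk_right
        rw [lintegral_const_mul' _ _ ENNReal.ofNat_ne_top, lintegral_add_left hsec]
    _ < ∞ := ENNReal.mul_lt_top ENNReal.ofNat_lt_top (ENNReal.add_lt_top.2 ⟨h1, h2⟩)

end IsSquareIntegrablyBounded

theorem exists_mem_timeIntegrals [SFinite P] (hT : 0 < T) (t : Icc (0 : ℝ) T)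
    (hφ : φ ∈ progSelections ℱ P Φ) :
    ∃ η ∈ timeIntegrals P t (progSelections ℱ P Φ),
      η =ᵐ[P] fun ω => ∫ s in Ici t, φ s ω ∂(timeMeasure T) :=
  have hL := memLp_setIntegral hT hφ.1 hφ.2.1 t
  ⟨hL.toLp _, ⟨φ, hφ, hL.coeFn_toLp⟩, hL.coeFn_toLp⟩

theorem aestronglyMeasurable_of_mem_decHull (hT : 0 < T) (t : Icc (0 : ℝ) T)
    {η : Lp (Vec d) 2 P}
    (hη : η ∈ decHull (terminalSigma hT ℱ) (timeIntegrals P t (progSelections ℱ P Φ))) :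
    AEStronglyMeasurable[terminalSigma hT ℱ] η P := by
  refine decHull_subset (isDecomposable_aestronglyMeasurable (terminalSigma hT ℱ)) ?_ hη
  rintro η ⟨φ, hφ, hηφ⟩
  exact ⟨_, stronglyMeasurable_setIntegral hT hφ.1 t, hηφ⟩

theorem IsSquareIntegrablyBounded.exists_isSetTimeIntegral [IsProbabilityMeasure P] (hT : 0 < T)
    (hΦ : IsSquareIntegrablyBounded ℱ P Φ) (t : Icc (0 : ℝ) T) :
    ∃ X, IsSetTimeIntegral hT ℱ P Φ t X := by
  obtain ⟨φ, hφ⟩ := hΦ.progSelections_nonempty hT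
  obtain ⟨η, hη, -⟩ := exists_mem_timeIntegrals hT t hφ
  have hη' := subset_decHull (terminalSigma hT ℱ) _ hη
  obtain ⟨X, hne, hc, hm, hS⟩ := IsDecomposable.exists_sqSelections_eq_closure (ℱ.le _)
    (isDecomposable_decHull (terminalSigma hT ℱ) (timeIntegrals P t (progSelections ℱ P Φ)))
    (fun f hf => aestronglyMeasurable_of_mem_decHull hT t hf) ⟨η, hη'⟩
  exact ⟨X, hne, hc, hm, hS ▸ ⟨η, subset_closure hη'⟩, hS⟩

theorem edist_setIntegral_le (t : Icc (0 : ℝ) T) {f g : Icc (0 : ℝ) T → Vec d}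
    (hf : Integrable f (timeMeasure T)) (hg : Integrable g (timeMeasure T)) :
    edist (∫ s in Ici t, f s ∂(timeMeasure T)) (∫ s in Ici t, g s ∂(timeMeasure T))
      ≤ (ENNReal.ofReal (T - t)
        * ∫⁻ s in Ici t, edist (f s) (g s) ^ 2 ∂(timeMeasure T)) ^ (1 / 2 : ℝ) := by
  rw [edist_eq_enorm_sub, ← integral_sub hf.restrict hg.restrict, one_div,
    ENNReal.le_rpow_inv_iff two_pos]
  simpa [edist_eq_enorm_sub] using enorm_setIntegral_sq_le t (hf.sub hg).restrict.1

/-- One half of the Hausdorff estimate: check the bound on time integrals by projecting onto `Ψ`,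
then extend it to the hull, its closure and all points of `X`. -/
theorem IsSetTimeIntegral.ae_infEDist_le [IsProbabilityMeasure P] {hT : 0 < T} {t : Icc (0 : ℝ) T}
    {X Y : Ω → Set (Vec d)} (hX : IsSetTimeIntegral hT ℱ P Φ t X)
    (hY : IsSetTimeIntegral hT ℱ P Ψ t Y) (hΨ : IsSquareIntegrablyBounded ℱ P Ψ) :
    ∀ᵐ ω ∂P, ∀ x ∈ X ω, Metric.infEDist x (Y ω) ≤ (ENNReal.ofReal (T - t) *
      ∫⁻ s in Ici t, Metric.hausdorffEDist (Φ s ω) (Ψ s ω) ^ 2 ∂(timeMeasure T)) ^ (1 / 2 : ℝ) := by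
  set ρ : Ω → ℝ≥0∞ := fun ω => (ENNReal.ofReal (T - t) *
    ∫⁻ s in Ici t, Metric.hausdorffEDist (Φ s ω) (Ψ s ω) ^ 2 ∂(timeMeasure T)) ^ (1 / 2 : ℝ)
  have hp : ∀ ω, IsClosed {x | Metric.infEDist x (Y ω) ≤ ρ ω} := fun ω =>
    isClosed_le Metric.continuous_infEDist continuous_const
  refine ae_forall_mem_of_sqSelections_subset (p := fun ω x => Metric.infEDist x (Y ω) ≤ ρ ω)
    (ℱ.le _) hX.measurable hX.isClosed hX.nonempty hX.integrable hp fun f hf => ?_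
  rw [hX.selections] at hf
  refine closure_minimal (decHull_subset (isDecomposable_setOf_ae (terminalSigma hT ℱ)
    fun ω x => Metric.infEDist x (Y ω) ≤ ρ ω) ?_) (isClosed_setOf_ae hp) hf
  rintro η ⟨φ, hφ, hηφ⟩
  have hψ := hΨ.nearest_mem_progSelections hT hφ.1
  obtain ⟨ζ, hζ, hζψ⟩ := exists_mem_timeIntegrals hT t hψ
  have hζY : ζ ∈ sqSelections P (terminalSigma hT ℱ) Y :=
    hY.selections ▸ subset_closure (subset_decHull _ _ hζ)
  rw [mem_ofPred_eq]
  filter_upwards [hηφ, hζψ, hζY.2, ae_ae_swap hφ.2.2,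
    ae_integrable_section hφ.2.1 (stronglyMeasurable_section hT hφ.1),
    ae_integrable_section hψ.2.1 (stronglyMeasurable_section hT hψ.1)] with ω h1 h2 h3 h4 h5 h6
  refine (Metric.infEDist_le_edist_of_mem h3).trans ?_
  rw [h1, h2]
  refine (edist_setIntegral_le t h5 h6).trans ?_
  refine ENNReal.rpow_le_rpow (mul_le_mul_right (lintegral_mono_ae ?_) _) (by norm_num)
  filter_upwards [ae_restrict_of_ae h4] with s hs
  rw [edist_nearest _ (hΨ.isClosed s ω) (hΨ.nonempty s ω)]
  exact pow_le_pow_left₀ bot_le (Metric.infEDist_le_hausdorffEDist_of_mem hs) 2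

end SetTimeIntegral

theorem proposition4p2 {d : ℕ} {T : ℝ} (hT : 0 < T)
    {Ω : Type*} {mΩ : MeasurableSpace Ω} (P : Measure Ω) [IsProbabilityMeasure P]
    (ℱ : Filtration (Icc (0 : ℝ) T) mΩ)
    (Φ₁ Φ₂ : Icc (0 : ℝ) T → Ω → Set (Vec d))
    (hΦ₁ : IsSquareIntegrablyBounded ℱ P Φ₁) (hΦ₂ : IsSquareIntegrablyBounded ℱ P Φ₂)
    (t : Icc (0 : ℝ) T) :
    (∃ X₁, IsSetTimeIntegral hT ℱ P Φ₁ t X₁) ∧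
    (∃ X₂, IsSetTimeIntegral hT ℱ P Φ₂ t X₂) ∧
    ∀ X₁ X₂ : Ω → Set (Vec d),
      IsSetTimeIntegral hT ℱ P Φ₁ t X₁ → IsSetTimeIntegral hT ℱ P Φ₂ t X₂ →
      ∀ᵐ ω ∂P,
        ∫⁻ s in Ici t, (Metric.hausdorffEDist (Φ₁ s ω) (Φ₂ s ω)) ^ 2 ∂(timeMeasure T) < ∞ ∧
        (Metric.hausdorffEDist (X₁ ω) (X₂ ω)) ^ 2 ≤
          ENNReal.ofReal (T - (t : ℝ)) *
            ∫⁻ s in Ici t, (Metric.hausdorffEDist (Φ₁ s ω) (Φ₂ s ω)) ^ 2 ∂(timeMeasure T) := by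
  refine ⟨hΦ₁.exists_isSetTimeIntegral hT t, hΦ₂.exists_isSetTimeIntegral hT t,
    fun X₁ X₂ hX₁ hX₂ => ?_⟩
  filter_upwards [hΦ₁.ae_lintegral_hausdorffEDist_lt_top hT hΦ₂, hX₁.ae_infEDist_le hX₂ hΦ₂,
    hX₂.ae_infEDist_le hX₁ hΦ₁] with ω hfin h₁₂ h₂₁
  refine ⟨(setLIntegral_le_lintegral _ _).trans_lt hfin, ?_⟩
  have hle := Metric.hausdorffEDist_le_of_infEDist h₁₂ (by
    simpa only [Metric.hausdorffEDist_comm] using h₂₁)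
  rw [one_div, ENNReal.le_rpow_inv_iff two_pos] at hle
  simpa using hle
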